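/- A modular ortholattice (MOL) is a bounded modular lattice $L$ with an order-reversing involution $a\mapsto a^\perp$ such that $a\cdot a^\perp=0$ and $a+a^\perp=1$ (join is written $+$, meet is written $\cdot$, and $a\oplus b$ denotes $a+b$ together with the assertion $a\cdot b=0$). It is simple if it has at least two elements and its only congruences are equality and the total relation. Its height is the supremum of $|C|-1$ over all chains $C$ in $L$. For $n\ge 1$ and $k\ge 0$, a stable orthogonal $(n,k)$-frame in a MOL $L$ consists of elements $a_i$ ($0\le i<n+k$), $a_{ij}$ ($0\le i<n$, $0\le j<n+k$) and $z_{ij}$ ($0\le j<n\le i<n+k$) of $L$ such that 1. the $a_i$ are independent with join $1$; 2. for all $i,j<n$, $a_{ij}$ is an axis of perspectivity between $a_j$ and $a_i$: $a_i+a_j=a_i\oplus a_{ij}=a_j\oplus a_{ij}$ (in particular $a_{ii}=0$); 3. for all $i<n\le j<n+k$, $a_{ij}$ is an axis of subperspectivity of $a_j$ to $a_i$: with $b_{ij}:=a_i\cdot(a_j+a_{ij})$ (the image of $a_j$ in $a_i$), $b_{ij}+a_j=a_j\oplus a_{ij}=b_{ij}\oplus a_{ij}$; 4. for all $i<n$ and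 $j<n+k$, $a_{ij}=(a_{0i}+a_{0j})\cdot(a_i+a_j)$; 5. for all $j<n\le i<n+k$, $z_{ij}$ is the relative orthocomplement of $b_{ji}$ in $[0,a_j]$: $z_{ij}=a_j\cdot b_{ji}^\perp$ and $b_{ji}\oplus z_{ij}=a_j$; 6. for all $i<n+k$, $a_i^\perp=\sum_{j\ne i}a_j$. **Corollary.** Let $n\ge1$ be an integer and let $L$ be a simple modular ortholattice of height at least $n$. Then there is $k\ge0$ such that $L$ contains a stable orthogonal $(n,k)$-frame. -/

import Mathlib

/-- A modular ortholattice (MOL): a bounded modular lattice together with an orthocomplementation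
`a ↦ aᶜ`, that is, an order-reversing involution sending each element to a complement of it. -/
class ModularOrtholattice (L : Type*) extends Lattice L, BoundedOrder L, Compl L,
    IsModularLattice L where
  compl_compl_eq : ∀ a : L, aᶜᶜ = a
  compl_le_compl_of_le : ∀ a b : L, a ≤ b → bᶜ ≤ aᶜ
  inf_compl_eq_bot_mol : ∀ a : L, a ⊓ aᶜ = ⊥
  sup_compl_eq_top_mol : ∀ a : L, a ⊔ aᶜ = ⊤

/-- A MOL is simple if it has at least two elements and its only congruences (equivalence relations
compatible with join, meet and orthocomplementation) are equality and the total relation. -/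
def ModularOrtholattice.IsSimple (L : Type*) [ModularOrtholattice L] : Prop :=
  Nontrivial L ∧ ∀ θ : LatticeCon L, (∀ x y : L, θ.r x y → θ.r xᶜ yᶜ) →
    (∀ x y : L, θ.r x y → x = y) ∨ (∀ x y : L, θ.r x y)

namespace LatticeFrame

/-- `c` is an axis of perspectivity between `a` and `b`: `a + b = a ⊕ c = b ⊕ c`. -/
def IsPerspAxis {L : Type*} [Lattice L] [BoundedOrder L] (a b c : L) : Prop :=
  a ⊔ b = a ⊔ c ∧ a ⊓ c = ⊥ ∧ a ⊔ b = b ⊔ c ∧ b ⊓ c = ⊥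

/-- The image `a · (b + c)` of `b` in `a` under the subperspectivity from `b` to `a` with
axis `c`. -/
def perspImage {L : Type*} [Lattice L] (b a c : L) : L := a ⊓ (b ⊔ c)

/-- `c` is an axis of subperspectivity from `b` to `a`:
`a(b + c) + b = b ⊕ c = a(b + c) ⊕ c`. -/
def IsSubperspAxis {L : Type*} [Lattice L] [BoundedOrder L] (b a c : L) : Prop :=
  IsPerspAxis (perspImage b a c) b c

/-- A (large partial) `(n,k)`-frame: the spanning elements are `a i`, `i < n + k`, and `c i` is the
axis of (sub)perspectivity between `a i` and `a 0`. Only values at indices `i < n + k` matter. -/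
structure IsFrame {L : Type*} [Lattice L] [BoundedOrder L] (n k : ℕ) (a c : ℕ → L) : Prop where
  indep : (Finset.range (n + k)).SupIndep a
  span : (Finset.range (n + k)).sup a = ⊤
  persp : ∀ i, 1 ≤ i → i < n → IsPerspAxis (a 0) (a i) (c i)
  subpersp : ∀ i, n ≤ i → i < n + k → IsSubperspAxis (a i) (a 0) (c i)

/-- A stable `(n,k)`-frame. Here `c i j` (`i < n`, `j < n + k`) is the axis of (sub)perspectivity
between `a j` and `a i`; it is the one constructed from the axes `c 0 i` and `c 0 j`. The element
`z i j` (`j < n ≤ i < n + k`) is a complement in `[⊥, a j]` of the image of `a i` in `a j`.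
In particular `c i i = ⊥` for `i < n`. -/
structure IsStableFrame {L : Type*} [Lattice L] [BoundedOrder L] (n k : ℕ)
    (a : ℕ → L) (c z : ℕ → ℕ → L) : Prop where
  frame : IsFrame n k a (c 0)
  axis_eq : ∀ i j, i < n → j < n + k → c i j = (c 0 i ⊔ c 0 j) ⊓ (a i ⊔ a j)
  persp : ∀ i j, i < n → j < n → IsPerspAxis (a i) (a j) (c i j)
  subpersp : ∀ i j, i < n → n ≤ j → j < n + k → IsSubperspAxis (a j) (a i) (c i j)
  relCompl_sup : ∀ i j, j < n → n ≤ i → i < n + k →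
    perspImage (a i) (a j) (c j i) ⊔ z i j = a j
  relCompl_inf : ∀ i j, j < n → n ≤ i → i < n + k →
    perspImage (a i) (a j) (c j i) ⊓ z i j = ⊥

/-- A stable orthogonal `(n,k)`-frame in a MOL: a stable frame in which the orthocomplement of each
`a i` is the join of the other `a j`, and in which each `z i j` is the relative orthocomplement in
`[⊥, a j]` of the image of `a i` in `a j`. -/
structure IsStableOrthogonalFrame {L : Type*} [ModularOrtholattice L] (n k : ℕ)
    (a : ℕ → L) (c z : ℕ → ℕ → L) : Prop where
  stable : IsStableFrame n k a c z
  orthogonal : ∀ i, i < n + k → (a i)ᶜ = ((Finset.range (n + k)).erase i).sup a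
  relOrtho : ∀ i j, j < n → n ≤ i → i < n + k →
    z i j = a j ⊓ (perspImage (a i) (a j) (c j i))ᶜ

end LatticeFrame

/-! Fix `a ≠ ⊥`. The finite orthogonal joins of elements perspective to parts of `a` (`OrthoDecomp
a`) are closed under joins and under passing to subperspective elements
(`OrthoDecomp.of_subpersp_left`, `OrthoDecomp.sup'`). Equality modulo joining such an element is
therefore a congruence, `perspCon a`, which identifies `a` with `⊥`; in a simple MOL it is total, so
every element is such a join (`IsSimple.orthoDecomp`).

A chain of length `n` gives `n` orthogonal nonzero elements. Decomposability lets them be shrunk to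
nonzero parts all perspective to one `a₀` (`IsSimple.exists_common_persp`). The orthocomplement of
their join is an orthogonal join of `k` elements subperspective to `a₀`. Axes to `a₀` then determine
all other axes (`IsPerspAxis.comp`), and orthogonality supplies independence. -/

namespace LatticeFrame

/-! ### Perspectivities in modular lattices. -/

section Modular

variable {L : Type*} [Lattice L] [BoundedOrder L]

/-- `x` and `y` are perspective via the common relative complement `c`, which need not lie
below `x ⊔ y`. -/
def PerspVia (c x y : L) : Prop :=
  x ⊔ c = y ⊔ c ∧ x ⊓ c = ⊥ ∧ y ⊓ c = ⊥

/-- `x` is perspective to a part of `a`. -/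
def Subpersp (x a : L) : Prop :=
  ∃ y ≤ a, ∃ c, PerspVia c x y

lemma PerspVia.symm {c x y : L} (h : PerspVia c x y) : PerspVia c y x :=
  ⟨h.1.symm, h.2.2, h.2.1⟩

lemma PerspVia.refl (x : L) : PerspVia ⊥ x x := by simp [PerspVia]

lemma IsPerspAxis.perspVia {x y c : L} (h : IsPerspAxis x y c) : PerspVia c x y :=
  ⟨h.1.symm.trans h.2.2.1, h.2.1, h.2.2.2⟩

lemma IsPerspAxis.symm {x y c : L} (h : IsPerspAxis x y c) : IsPerspAxis y x c :=
  ⟨sup_comm y x ▸ h.2.2.1, h.2.2.2, sup_comm y x ▸ h.1, h.2.1⟩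

lemma IsPerspAxis.le_sup {x y c : L} (h : IsPerspAxis x y c) : c ≤ x ⊔ y :=
  h.1 ▸ le_sup_right

lemma isPerspAxis_self (x : L) : IsPerspAxis x x ⊥ := by simp [IsPerspAxis]

lemma PerspVia.ne_bot {c x y : L} (h : PerspVia c x y) (hx : x ≠ ⊥) :
    y ≠ ⊥ := by
  rintro rfl
  obtain ⟨h1, h2, -⟩ := h
  rw [bot_sup_eq, sup_eq_right] at h1
  exact hx ((inf_eq_left.2 h1).symm.trans h2)

lemma Subpersp.of_le {x a : L} (h : x ≤ a) : Subpersp x a := ⟨x, h, ⊥, .refl x⟩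

lemma Subpersp.mono {x a b : L} (h : Subpersp x a) (hab : a ≤ b) : Subpersp x b :=
  let ⟨y, hy, c, hc⟩ := h
  ⟨y, hy.trans hab, c, hc⟩

variable [IsModularLattice L]

lemma PerspVia.isPerspAxis {c x y : L} (h : PerspVia c x y) :
    IsPerspAxis x y (c ⊓ (x ⊔ y)) := by
  obtain ⟨h1, h2, h3⟩ := h
  refine ⟨?_, ?_, ?_, ?_⟩
  · rw [← sup_inf_assoc_of_le c (le_sup_left : x ≤ x ⊔ y)]
    exact (inf_eq_right.2 (sup_le le_sup_left (h1 ▸ le_sup_left))).symm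
  · rw [← inf_assoc, h2, bot_inf_eq]
  · rw [← sup_inf_assoc_of_le c (le_sup_right : y ≤ x ⊔ y)]
    exact (inf_eq_right.2 (sup_le (h1 ▸ le_sup_left) le_sup_left)).symm
  · rw [← inf_assoc, h3, bot_inf_eq]

/-- A perspectivity restricts to parts. -/
lemma PerspVia.restrict {c x y x' : L} (h : PerspVia c x y) (hx : x' ≤ x) :
    PerspVia c x' (y ⊓ (x' ⊔ c)) := by
  obtain ⟨h1, h2, h3⟩ := h
  refine ⟨?_, ?_, ?_⟩
  · rw [sup_comm (y ⊓ _) c, ← sup_inf_assoc_of_le y (le_sup_right : c ≤ x' ⊔ c), sup_comm c y, ← h1]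
    exact (inf_eq_right.2 (sup_le_sup_right hx c)).symm
  · exact le_bot_iff.1 (h2 ▸ inf_le_inf_right c hx)
  · exact le_bot_iff.1 (h3 ▸ inf_le_inf_right c inf_le_left)

/-- Images of disjoint elements under a perspectivity are disjoint. -/
lemma PerspVia.image_inf_eq_bot {c x y u v : L} (h : PerspVia c x y) (hu : u ≤ x) (hv : v ≤ x)
    (huv : u ⊓ v = ⊥) : (y ⊓ (u ⊔ c)) ⊓ (y ⊓ (v ⊔ c)) = ⊥ := by
  obtain ⟨-, h2, h3⟩ := h
  have e : x ⊓ (v ⊔ c) = v := by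
    rw [inf_comm, sup_inf_assoc_of_le c hv, inf_comm, h2, sup_bot_eq]
  -- Disjointness of `u` and `v` survives modulo `c`, since `v` is recovered from `v ⊔ c` by meeting
  -- with `x`.
  have e2 : (u ⊔ c) ⊓ (v ⊔ c) = c := by
    rw [sup_comm u c, sup_inf_assoc_of_le u (le_sup_right : c ≤ v ⊔ c), sup_eq_left]
    have : u ⊓ (v ⊔ c) ≤ ⊥ := by
      rw [← huv]
      exact le_inf inf_le_left ((inf_le_inf_right _ hu).trans e.le)
    exact this.trans bot_le
  rw [← inf_inf_distrib_left, e2, h3]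

/-- An element below `y ⊔ v` and disjoint from `y` is perspective to a part of `v`. -/
lemma subpersp_of_le_sup {x y v : L} (h : x ≤ y ⊔ v) (hxy : x ⊓ y = ⊥) (c : L)
    (hc : c ≤ v) (hcy : c ⊓ y = ⊥) (hcv : y ⊔ c = y ⊔ v) : Subpersp x v := by
  have hp : c ⊓ (x ⊔ y) ⊓ y = ⊥ := le_bot_iff.1 (hcy ▸ inf_le_inf_right y inf_le_left)
  refine ⟨c ⊓ (x ⊔ y), inf_le_left.trans hc, y, ?_, hxy, hp⟩
  rw [sup_comm (_ ⊓ _) y, ← sup_inf_assoc_of_le c (le_sup_right : y ≤ x ⊔ y), hcv]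
  exact (inf_eq_right.2 (sup_le h le_sup_left)).symm

/-! ### Composition of axes. -/

/-- Composition of a subperspectivity of `v` to `a` with a perspectivity between `a` and an
element `u` independent of them. -/
lemma IsPerspAxis.comp {a b u v p q : L} (hp : IsPerspAxis a u p) (hq : IsPerspAxis b v q)
    (hba : b ≤ a) (hv : v ⊓ (a ⊔ u) = ⊥) :
    IsSubperspAxis v u ((p ⊔ q) ⊓ (u ⊔ v)) := by
  -- Since `v` is disjoint from `a ⊔ u`, the elements `a ⊔ u` and `a ⊔ v` overlap only in `a`. Hence
  -- `p ⊔ q` cuts `b ⊔ v` in `q` and `a ⊔ u` in `p`, and so is disjoint from both `v` and `u`.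
  have hav : (a ⊔ u) ⊓ (a ⊔ v) = a := by
    rw [inf_comm, sup_inf_assoc_of_le v (le_sup_left : a ≤ a ⊔ u), hv, sup_bot_eq]
  have h1 : v ⊓ (p ⊔ q) = ⊥ := by
    have e : (q ⊔ p) ⊓ (b ⊔ v) = q := by
      rw [sup_inf_assoc_of_le p hq.le_sup, sup_eq_left]
      have : p ⊓ (b ⊔ v) ≤ a ⊓ p := le_inf
        (hav ▸ inf_le_inf hp.le_sup (sup_le_sup_right hba v)) inf_le_left
      exact (this.trans hp.2.1.le).trans bot_le
    apply le_bot_iff.1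
    rw [← hq.2.2.2]
    refine le_inf inf_le_left (le_trans ?_ e.le)
    rw [sup_comm q p]
    exact le_inf inf_le_right (inf_le_left.trans le_sup_right)
  have h2 : u ⊓ (p ⊔ q) = ⊥ := by
    have e : (p ⊔ q) ⊓ (a ⊔ u) = p := by
      rw [sup_inf_assoc_of_le q hp.le_sup, sup_eq_left]
      have e3 : (b ⊔ v) ⊓ (a ⊔ u) = b := by
        rw [sup_inf_assoc_of_le v (hba.trans le_sup_left), hv, sup_bot_eq]
      have : q ⊓ (a ⊔ u) ≤ b ⊓ q := le_inf (e3 ▸ inf_le_inf_right _ hq.le_sup) inf_le_left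
      exact (this.trans hq.2.1.le).trans bot_le
    apply le_bot_iff.1
    rw [← hp.2.2.2]
    refine le_inf inf_le_left (le_trans ?_ e.le)
    exact le_inf inf_le_right (inf_le_left.trans le_sup_right)
  set c := (p ⊔ q) ⊓ (u ⊔ v) with hc
  have h3 : (u ⊓ (v ⊔ c)) ⊔ v = v ⊔ c := by
    rw [sup_comm, ← sup_inf_assoc_of_le u (le_sup_left : v ≤ v ⊔ c), inf_eq_right, sup_comm v u]
    exact sup_le le_sup_right inf_le_right
  have h4 : v ≤ u ⊔ c := by
    rw [hc, ← sup_inf_assoc_of_le _ (le_sup_left : u ≤ u ⊔ v)]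
    refine le_inf ?_ le_sup_right
    have : b ≤ u ⊔ p := hp.2.2.1 ▸ hba.trans le_sup_left
    calc v ≤ b ⊔ v := le_sup_right
      _ = b ⊔ q := hq.1
      _ ≤ u ⊔ p ⊔ q := sup_le_sup_right this q
      _ = _ := sup_assoc ..
  have h5 : (u ⊓ (v ⊔ c)) ⊔ c = v ⊔ c := by
    rw [sup_comm, ← sup_inf_assoc_of_le u (le_sup_right : c ≤ v ⊔ c), inf_eq_right, sup_comm c u]
    exact sup_le h4 le_sup_right
  refine ⟨h3.trans h5.symm, ?_, h3, ?_⟩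
  · refine le_bot_iff.1 (h2 ▸ ?_)
    exact inf_le_inf inf_le_left inf_le_left
  · exact le_bot_iff.1 (h1 ▸ inf_le_inf_left v inf_le_left)

lemma IsPerspAxis.comp_image {a u v p q : L} (hp : IsPerspAxis a u p) (hq : IsPerspAxis a v q) :
    perspImage v u ((p ⊔ q) ⊓ (u ⊔ v)) = u := by
  rw [perspImage, inf_eq_left, ← sup_inf_assoc_of_le _ (le_sup_right : v ≤ u ⊔ v)]
  refine le_inf ?_ le_sup_left
  calc u ≤ a ⊔ u := le_sup_right
    _ = a ⊔ p := hp.1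
    _ ≤ (a ⊔ v) ⊔ p := sup_le_sup_right le_sup_left p
    _ = v ⊔ (p ⊔ q) := by rw [hq.2.2.1, sup_assoc, sup_comm q p]

lemma IsPerspAxis.trans {a u v p q : L} (hp : IsPerspAxis a u p) (hq : IsPerspAxis a v q)
    (hv : v ⊓ (a ⊔ u) = ⊥) : IsPerspAxis u v ((p ⊔ q) ⊓ (u ⊔ v)) := by
  simpa only [IsSubperspAxis, hp.comp_image hq] using hp.comp hq le_rfl hv

/-- An axis between `v` and a part of `a`, disjoint from `v`, is an axis of subperspectivity. -/
lemma IsPerspAxis.isSubperspAxis {a b v q : L} (hq : IsPerspAxis b v q) (hba : b ≤ a)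
    (hv : v ⊓ a = ⊥) : IsSubperspAxis v a q := by
  have : perspImage v a q = b := by
    rw [perspImage, ← hq.2.2.1, inf_comm, sup_inf_assoc_of_le v hba, hv, sup_bot_eq]
  rwa [IsSubperspAxis, this]

end Modular

end LatticeFrame

/-! ### Orthocomplements and relative orthocomplements. -/

namespace ModularOrtholattice

open LatticeFrame

variable {L : Type*} [ModularOrtholattice L]

lemma compl_anti {a b : L} (h : a ≤ b) : bᶜ ≤ aᶜ := compl_le_compl_of_le a b h

lemma le_compl_symm {a b : L} (h : a ≤ bᶜ) : b ≤ aᶜ := compl_compl_eq b ▸ compl_anti h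

lemma inf_eq_bot_of_le_compl {a b : L} (h : a ≤ bᶜ) : a ⊓ b = ⊥ :=
  le_bot_iff.1 (inf_compl_eq_bot_mol b ▸ le_inf inf_le_right (inf_le_left.trans h))

lemma compl_sup_eq (a b : L) : (a ⊔ b)ᶜ = aᶜ ⊓ bᶜ :=
  le_antisymm (le_inf (compl_anti le_sup_left) (compl_anti le_sup_right))
    (le_compl_symm (sup_le (le_compl_symm inf_le_left) (le_compl_symm inf_le_right)))

lemma sup_inf_compl {a b : L} (h : a ≤ b) : a ⊔ b ⊓ aᶜ = b := by
  rw [inf_comm, ← sup_inf_assoc_of_le aᶜ h, sup_compl_eq_top_mol, top_inf_eq]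

lemma inf_inf_compl (a b : L) : a ⊓ (b ⊓ aᶜ) = ⊥ := by
  rw [inf_comm]
  exact inf_eq_bot_of_le_compl inf_le_right

lemma compl_eq_of_sup_eq_top {a b : L} (h : b ≤ aᶜ) (hab : a ⊔ b = ⊤) : aᶜ = b := by
  have e : a ⊓ aᶜ = ⊥ := inf_compl_eq_bot_mol a
  rw [← top_inf_eq aᶜ, ← hab, sup_comm, sup_inf_assoc_of_le a h, e, sup_bot_eq]

lemma subpersp_mono_left {x x' a : L} (h : Subpersp x a) (hx : x' ≤ x) : Subpersp x' a :=
  let ⟨y, hy, c, hc⟩ := h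
  ⟨y ⊓ (x' ⊔ c), inf_le_left.trans hy, c, hc.restrict hx⟩

/-- The orthocomplement of `v ⊓ y` relative to `v` complements `y` in `y ⊔ v`, which is what
`subpersp_of_le_sup` asks for. This is the main source of subperspectivities below. -/
lemma subpersp_of_le_sup_of_inf_eq_bot {x y v : L} (h : x ≤ y ⊔ v) (hxy : x ⊓ y = ⊥) :
    Subpersp x v := by
  have e : v ⊓ y ⊔ v ⊓ (v ⊓ y)ᶜ = v := sup_inf_compl inf_le_left
  refine subpersp_of_le_sup h hxy (v ⊓ (v ⊓ y)ᶜ) inf_le_left ?_ ?_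
  · have := inf_inf_compl (v ⊓ y) v
    rw [← le_bot_iff, ← this]
    exact le_inf (le_inf (inf_le_left.trans inf_le_left) inf_le_right) inf_le_left
  · apply le_antisymm (sup_le_sup_left inf_le_left y)
    refine sup_le le_sup_left (e.symm.le.trans ?_)
    exact sup_le_sup_right inf_le_right _

/-! ### Closure properties of orthogonal decompositions. -/

/-- `x` is a finite orthogonal join of elements that are perspective to parts of `a`. -/
inductive OrthoDecomp (a : L) : L → Prop
  | of_subpersp {x : L} (h : Subpersp x a) : OrthoDecomp a x
  | sup {x y : L} (hx : OrthoDecomp a x) (hy : OrthoDecomp a y) (hxy : x ≤ yᶜ) :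
      OrthoDecomp a (x ⊔ y)

namespace OrthoDecomp

lemma of_split {a x x' : L} (h : x' ≤ x) (h1 : OrthoDecomp a x')
    (h2 : OrthoDecomp a (x ⊓ x'ᶜ)) : OrthoDecomp a x := by
  rw [← sup_inf_compl h]
  exact h1.sup h2 (le_compl_symm inf_le_right)

lemma bind {a b x : L} (h : OrthoDecomp b x)
    (hab : ∀ y, Subpersp y b → OrthoDecomp a y) : OrthoDecomp a x := by
  induction h with
  | of_subpersp h => exact hab _ h
  | sup _ _ hxy h1 h2 => exact h1.sup h2 hxy

/-- Perspectivity is not transitive, so `x` is split. The part below `y ⊔ v` is disjoint from `y`,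
hence subperspective to `v`; the rest is disjoint from `y ⊔ v`, where perspectivities do compose. -/
lemma of_persp_of_disjoint {c d x y v : L} (hx : PerspVia c x y) (hy : PerspVia d y v)
    (hxy : x ⊓ y = ⊥) : OrthoDecomp v x := by
  refine of_split (x' := x ⊓ (y ⊔ v)) inf_le_left (.of_subpersp ?_) (.of_subpersp ?_)
  · exact subpersp_of_le_sup_of_inf_eq_bot inf_le_right
      (le_bot_iff.1 (hxy ▸ inf_le_inf_right y inf_le_left))
  · set x' := x ⊓ (x ⊓ (y ⊔ v))ᶜ
    have hd : x' ⊓ (y ⊔ v) = ⊥ := by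
      rw [← le_bot_iff, ← inf_inf_compl (x ⊓ (y ⊔ v)) x]
      exact le_inf (le_inf (inf_le_left.trans inf_le_left) inf_le_right) inf_le_left
    have p1 := hx.restrict (inf_le_left : x' ≤ x)
    set y' := y ⊓ (x' ⊔ c)
    have hy' : y' ≤ y := inf_le_left
    have p2 := hy.restrict hy'
    set v' := v ⊓ (y' ⊔ d)
    have hv' : v' ≤ v := inf_le_left
    have p3 := p2.isPerspAxis.trans p1.symm.isPerspAxis
      (le_bot_iff.1 (hd ▸ inf_le_inf_left _ (sup_le_sup hy' hv')))
    exact ⟨v', hv', _, p3.symm.perspVia⟩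

/-- Splitting off `x ⊓ y`, which as a part of `y` is already subperspective to `v`, reduces to the
disjoint case. -/
lemma of_persp {c d x y v : L} (hx : PerspVia c x y) (hy : PerspVia d y v) :
    OrthoDecomp v x := by
  refine of_split (x' := x ⊓ y) inf_le_left (.of_subpersp ?_) ?_
  · exact subpersp_mono_left ⟨v, le_rfl, d, hy⟩ inf_le_right
  · set x' := x ⊓ (x ⊓ y)ᶜ
    have p1 := hx.restrict (inf_le_left : x' ≤ x)
    set y' := y ⊓ (x' ⊔ c)
    have hy' : y' ≤ y := inf_le_left
    have p2 := hy.restrict hy'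
    have hv' : v ⊓ (y' ⊔ d) ≤ v := inf_le_left
    have hd : x' ⊓ y' = ⊥ := by
      rw [← le_bot_iff, ← inf_inf_compl (x ⊓ y) x]
      exact le_inf (le_inf (inf_le_left.trans inf_le_left) (inf_le_right.trans hy')) inf_le_left
    exact (of_persp_of_disjoint p1 p2 hd).bind fun y h => .of_subpersp (h.mono hv')

lemma of_subpersp_trans {x y a : L} (h : Subpersp x y) (h' : Subpersp y a) :
    OrthoDecomp a x := by
  obtain ⟨w, hw, c, hc⟩ := h
  obtain ⟨v, hv, d, hd⟩ := subpersp_mono_left h' hw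
  exact (of_persp hc hd).bind fun y h => .of_subpersp (h.mono hv)

lemma of_subpersp_left {x y a : L} (hy : OrthoDecomp a y) (h : Subpersp x y) :
    OrthoDecomp a x := by
  induction hy generalizing x with
  | of_subpersp hy => exact of_subpersp_trans h hy
  | @sup u v _ _ huv hu hv =>
    obtain ⟨w, hw, c, hc⟩ := h
    have q := hc.symm.restrict (inf_le_left : w ⊓ u ≤ w)
    -- The part of `x` corresponding to `w ⊓ u` is covered by the hypothesis on `u`. The remainder
    -- corresponds to a part of `w` disjoint from `u`, hence subperspective to `v`.
    refine of_split (x' := x ⊓ (w ⊓ u ⊔ c)) inf_le_left (hu ⟨w ⊓ u, inf_le_right, c, q.symm⟩) ?_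
    set x₁ := x ⊓ (w ⊓ u ⊔ c)
    set x' := x ⊓ x₁ᶜ
    have p1 := hc.restrict (inf_le_left : x' ≤ x)
    have hd : w ⊓ (x' ⊔ c) ⊓ u = ⊥ := by
      have := hc.image_inf_eq_bot (inf_le_left : x₁ ≤ x) (inf_le_left : x' ≤ x)
        (inf_inf_compl x₁ x)
      rw [← le_bot_iff, ← this]
      refine le_inf (le_inf (inf_le_left.trans inf_le_left) ?_) inf_le_left
      exact (inf_le_inf_right u inf_le_left).trans (q.1 ▸ le_sup_left)
    set w' := w ⊓ (x' ⊔ c)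
    have hw' : w' ≤ w := inf_le_left
    exact (of_subpersp_trans ⟨w', le_rfl, c, p1⟩
      (subpersp_of_le_sup_of_inf_eq_bot (hw'.trans hw) hd)).bind fun y h => hv h

/-- Orthogonality is restored by replacing `y` with the part of `x ⊔ y` orthogonal to `x`, which is
subperspective to `y`. -/
lemma sup' {a x y : L} (hx : OrthoDecomp a x) (hy : OrthoDecomp a y) : OrthoDecomp a (x ⊔ y) := by
  refine of_split le_sup_left hx (hy.of_subpersp_left ?_)
  exact subpersp_of_le_sup_of_inf_eq_bot inf_le_left (inf_eq_bot_of_le_compl inf_le_right)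

end OrthoDecomp

/-! ### The congruence collapsing an element, and the use of simplicity. -/

/-- Passing from `z` to `z ⊔ i` removes from `zᶜ` only `zᶜ ⊓ (z ⊔ i)`, which is subperspective to
`i`. Compatibility with complements also yields compatibility with meets, by De Morgan. -/
lemma exists_compl_sup_eq {a x y i : L} (hi : OrthoDecomp a i) (h : x ⊔ i = y ⊔ i) :
    ∃ j, OrthoDecomp a j ∧ xᶜ ⊔ j = yᶜ ⊔ j := by
  have key : ∀ z : L, ∃ r, OrthoDecomp a r ∧ zᶜ = (z ⊔ i)ᶜ ⊔ r := fun z => by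
    refine ⟨zᶜ ⊓ (z ⊔ i), hi.of_subpersp_left (subpersp_of_le_sup_of_inf_eq_bot (y := z)
      inf_le_right (inf_eq_bot_of_le_compl inf_le_left)), ?_⟩
    have := sup_inf_compl (compl_anti (le_sup_left : z ≤ z ⊔ i))
    rw [compl_compl_eq] at this
    exact this.symm
  obtain ⟨r, hr, hx⟩ := key x
  obtain ⟨s, hs, hy⟩ := key y
  refine ⟨r ⊔ s, hr.sup' hs, ?_⟩
  rw [hx, hy, h, sup_sup_sup_comm, sup_assoc, sup_assoc, ← sup_assoc r r s, sup_idem,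
    sup_left_comm s r s, sup_idem]

/-- The congruence of a MOL that collapses `a`. -/
def perspCon (a : L) : LatticeCon L where
  r x y := ∃ i, OrthoDecomp a i ∧ x ⊔ i = y ⊔ i
  iseqv :=
    { refl := fun x => ⟨a, .of_subpersp (.of_le le_rfl), rfl⟩
      symm := fun ⟨i, hi, h⟩ => ⟨i, hi, h.symm⟩
      trans := fun {x y z} ⟨i, hi, h⟩ ⟨j, hj, h'⟩ => ⟨i ⊔ j, hi.sup' hj, by
        rw [← sup_assoc, h, sup_right_comm, h', sup_right_comm, sup_assoc]⟩ }
  inf := by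
    rintro w x y z ⟨i, hi, h⟩ ⟨j, hj, h'⟩
    obtain ⟨i, hi, h⟩ := exists_compl_sup_eq hi h
    obtain ⟨j, hj, h'⟩ := exists_compl_sup_eq hj h'
    have : (wᶜ ⊔ yᶜ) ⊔ (i ⊔ j) = (xᶜ ⊔ zᶜ) ⊔ (i ⊔ j) := by
      rw [sup_sup_sup_comm, h, h', sup_sup_sup_comm]
    obtain ⟨k, hk, h⟩ := exists_compl_sup_eq (hi.sup' hj) this
    refine ⟨k, hk, ?_⟩
    simpa only [compl_sup_eq, compl_compl_eq] using h
  sup := by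
    rintro w x y z ⟨i, hi, h⟩ ⟨j, hj, h'⟩
    exact ⟨i ⊔ j, hi.sup' hj, by rw [sup_sup_sup_comm, h, h', sup_sup_sup_comm]⟩

/-- In a simple MOL every element is a finite orthogonal join of elements perspective to parts
of any given nonzero element. -/
theorem IsSimple.orthoDecomp (hL : IsSimple L) {a : L} (ha : a ≠ ⊥) (x : L) :
    OrthoDecomp a x := by
  rcases hL.2 (perspCon a) fun x y ⟨i, hi, h⟩ => exists_compl_sup_eq hi h with h | h
  · exact absurd (h a ⊥ ⟨a, .of_subpersp (.of_le le_rfl), by simp⟩) ha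
  · obtain ⟨i, hi, e⟩ := h x ⊥
    refine hi.of_subpersp_left (.of_le ?_)
    rw [bot_sup_eq] at e
    exact e ▸ le_sup_left

/-- The last clause says that `x` is the join of the `b i`; as a universal property it is easily
checked for concatenated sequences. -/
lemma OrthoDecomp.exists_seq {a x : L} (h : OrthoDecomp a x) :
    ∃ (k : ℕ) (b : ℕ → L), (∀ i j, i < k → j < k → i ≠ j → b i ≤ (b j)ᶜ) ∧
      (∀ i, i < k → Subpersp (b i) a) ∧ ∀ y, x ≤ y ↔ ∀ i, i < k → b i ≤ y := by
  induction h with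
  | @of_subpersp x h =>
    exact ⟨1, fun _ => x, fun i j hi hj hij => by omega, fun _ _ => h,
      fun y => ⟨fun h _ _ => h, fun h => h 0 one_pos⟩⟩
  | @sup x y _ _ hxy hx hy =>
    obtain ⟨k, b, hb, hba, hbx⟩ := hx
    obtain ⟨l, d, hd, hda, hdy⟩ := hy
    have hbd : ∀ i j, i < k → j < l → b i ≤ (d j)ᶜ := fun i j hi hj =>
      (((hbx x).1 le_rfl i hi).trans hxy).trans (compl_anti ((hdy y).1 le_rfl j hj))
    refine ⟨k + l, fun i => if i < k then b i else d (i - k), ?_, ?_, ?_⟩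
    · intro i j hi hj hij
      by_cases h1 : i < k <;> by_cases h2 : j < k <;> simp only [h1, h2, if_true, if_false]
      · exact hb i j h1 h2 hij
      · exact hbd _ _ h1 (by omega)
      · exact le_compl_symm (hbd _ _ h2 (by omega))
      · exact hd _ _ (by omega) (by omega) (by omega)
    · intro i hi
      by_cases h1 : i < k <;> simp only [h1, if_true, if_false]
      · exact hba i h1
      · exact hda _ (by omega)
    · intro w
      rw [sup_le_iff, hbx, hdy]
      constructor
      · rintro ⟨h1, h2⟩ i hi
        by_cases h3 : i < k <;> simp only [h3, if_true, if_false]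
        · exact h1 i h3
        · exact h2 _ (by omega)
      · refine fun h => ⟨fun i hi => ?_, fun i hi => ?_⟩
        · simpa [hi] using h i (by omega)
        · simpa using h (k + i) (by omega)

lemma OrthoDecomp.exists_subpersp_ne_bot {a x : L} (h : OrthoDecomp a x) (hx : x ≠ ⊥) :
    ∃ f ≤ x, f ≠ ⊥ ∧ Subpersp f a := by
  induction h with
  | @of_subpersp x h => exact ⟨x, le_rfl, hx, h⟩
  | @sup x y _ _ _ h1 h2 =>
    by_cases h : x = ⊥
    · obtain ⟨f, hf, h⟩ := h2 fun h' => hx (by rw [h, h', sup_idem])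
      exact ⟨f, hf.trans le_sup_right, h⟩
    · obtain ⟨f, hf, h⟩ := h1 h
      exact ⟨f, hf.trans le_sup_left, h⟩

/-! ### Orthogonal families and common perspective parts. -/

/-- In a simple MOL, nonzero elements have mutually perspective nonzero parts. -/
lemma IsSimple.exists_common_persp (hL : IsSimple L) (e : ℕ → L) (m : ℕ)
    (he : ∀ i ≤ m, e i ≠ ⊥) :
    ∃ a ≤ e 0, a ≠ ⊥ ∧ ∀ i ≤ m, ∃ f ≤ e i, ∃ c, PerspVia c a f := by
  induction m with
  | zero =>
    refine ⟨e 0, le_rfl, he 0 le_rfl, fun i hi => ?_⟩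
    obtain rfl : i = 0 := by omega
    exact ⟨_, le_rfl, _, .refl _⟩
  | succ m ih =>
    obtain ⟨a, hae, ha, h⟩ := ih fun i hi => he i (by omega)
    obtain ⟨f, hf, hf0, a', ha', c, hc⟩ :=
      (hL.orthoDecomp ha (e (m + 1))).exists_subpersp_ne_bot (he _ le_rfl)
    -- Shrinking `a` to `a'` accommodates the new element; the earlier perspectivities restrict to
    -- `a'`.
    refine ⟨a', ha'.trans hae, hc.ne_bot hf0, fun i hi => ?_⟩
    rcases Nat.le_succ_iff.1 hi with hi | rfl
    · obtain ⟨g, hg, d, hd⟩ := h i hi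
      exact ⟨_, inf_le_left.trans hg, d, hd.restrict ha'⟩
    · exact ⟨f, hf, c, hc.symm⟩

/-- A chain of length `n` yields `n` pairwise orthogonal nonzero elements. -/
lemma exists_orthogonal_ne_bot {n : ℕ} (h : (n : WithBot ℕ∞) ≤ Order.krullDim L) :
    ∃ e : ℕ → L, (∀ i, i < n → e i ≠ ⊥) ∧
      ∀ i j, i < n → j < n → i ≠ j → e i ≤ (e j)ᶜ := by
  obtain ⟨l, rfl⟩ := Order.le_krullDim_iff.1 h
  let g : ℕ → L := fun i => if h : i < l.length + 1 then l ⟨i, h⟩ else ⊤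
  have hg : ∀ i j, i < j → j < l.length + 1 → g i < g j := fun i j hij hj => by
    simp only [g, hj, hij.trans hj, dif_pos]
    exact l.strictMono hij
  have hg' : ∀ i j, i ≤ j → j < l.length + 1 → g i ≤ g j := fun i j hij hj =>
    hij.eq_or_lt.elim (fun h => h ▸ le_rfl) fun h => (hg i j h hj).le
  have lt : ∀ i j, i < j → j < l.length →
      g (i + 1) ⊓ (g i)ᶜ ≤ (g (j + 1) ⊓ (g j)ᶜ)ᶜ := fun i j hij hj =>
    le_compl_symm (inf_le_right.trans (compl_anti
      (inf_le_left.trans (hg' (i + 1) j hij (by omega)))))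
  -- Successive differences in the chain: nonzero by strictness, orthogonal by monotonicity.
  refine ⟨fun i => g (i + 1) ⊓ (g i)ᶜ, fun i hi h0 => ?_, fun i j hi hj hij => ?_⟩
  · have hi' := hg i (i + 1) (by omega) (by omega)
    have := sup_inf_compl hi'.le
    rw [show g (i + 1) ⊓ (g i)ᶜ = ⊥ from h0, sup_bot_eq] at this
    exact hi'.ne this
  · rcases Nat.lt_or_gt_of_ne hij with h | h
    · exact lt i j h hj
    · exact le_compl_symm (lt j i h hi)

/-! ### Assembly of the frame. -/

/-- Orthogonal elements spanning a MOL, the first `n` perspective and the others subperspective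
to the first, form a stable orthogonal frame. -/
theorem exists_isStableOrthogonalFrame {n k : ℕ} (hn : 1 ≤ n) (a : ℕ → L)
    (ho : ∀ i j, i < n + k → j < n + k → i ≠ j → a i ≤ (a j)ᶜ)
    (htop : ∀ y, (∀ i, i < n + k → a i ≤ y) → y = ⊤)
    (hp : ∀ i, i < n → ∃ c, PerspVia c (a 0) (a i))
    (hs : ∀ i, n ≤ i → i < n + k → Subpersp (a i) (a 0)) :
    ∃ c z, IsStableOrthogonalFrame n k a c z := by
  -- `q i` is the axis between `a i` and a part `b` of `a 0`, with `b = a 0` when `i < n`. The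
  -- choice `q 0 = ⊥` makes `c 0 j` below reduce to `q j`, so that `axis_eq` holds.
  have key : ∀ i, ∃ q, i < n + k → (i = 0 → q = ⊥) ∧ (i < n → IsPerspAxis (a 0) (a i) q) ∧
      ∃ b ≤ a 0, IsPerspAxis b (a i) q := by
    intro i
    by_cases hi : i < n + k
    · rcases Nat.eq_zero_or_pos i with rfl | hi0
      · exact ⟨⊥, fun _ => ⟨fun _ => rfl, fun _ => isPerspAxis_self _, a 0, le_rfl,
          isPerspAxis_self _⟩⟩
      · by_cases hin : i < n
        · obtain ⟨c, hc⟩ := hp i hin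
          exact ⟨_, fun _ => ⟨fun h => by omega, fun _ => hc.isPerspAxis, a 0, le_rfl,
            hc.isPerspAxis⟩⟩
        · obtain ⟨b, hb, c, hc⟩ := hs i (by omega) hi
          exact ⟨_, fun _ => ⟨fun h => by omega, fun h => absurd h hin, b, hb,
            hc.symm.isPerspAxis⟩⟩
    · exact ⟨⊥, fun h => absurd h hi⟩
  choose q hq using key
  have hq0 : q 0 = ⊥ := (hq 0 (by omega)).1 rfl
  let c : ℕ → ℕ → L := fun i j => (q i ⊔ q j) ⊓ (a i ⊔ a j)
  have hc0 : ∀ j, j < n + k → c 0 j = q j := fun j hj => by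
    obtain ⟨b, hb, hbq⟩ := (hq j hj).2.2
    simpa [c, hq0] using hbq.le_sup.trans (sup_le_sup_right hb _)
  have hci0 : ∀ i, i < n + k → c i 0 = q i := fun i hi => by
    rw [← hc0 i hi]
    simp only [c, sup_comm]
  have hcii : ∀ i, i < n → c i i = ⊥ := fun i hi => by
    simpa [c, inf_comm] using ((hq i (by omega)).2.1 hi).2.2.2
  have hd : ∀ i j, i < n + k → j < n + k → i ≠ j → a i ⊓ a j = ⊥ := fun i j hi hj hij =>
    inf_eq_bot_of_le_compl (ho i j hi hj hij)
  have hd3 : ∀ i j, i < n + k → j < n + k → i ≠ j → 0 ≠ j → a j ⊓ (a 0 ⊔ a i) = ⊥ :=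
    fun i j hi hj hij hj0 => by
      rw [inf_comm]
      exact inf_eq_bot_of_le_compl (sup_le (ho 0 j (by omega) hj hj0) (ho i j hi hj hij))
  have hpersp : ∀ i j, i < n → j < n → IsPerspAxis (a i) (a j) (c i j) := fun i j hi hj => by
    by_cases hij : i = j
    · subst hij
      rw [hcii i hi]
      exact isPerspAxis_self _
    by_cases hj0 : j = 0
    · subst hj0
      rw [hci0 i (by omega)]
      exact ((hq i (by omega)).2.1 hi).symm
    · exact ((hq i (by omega)).2.1 hi).trans ((hq j (by omega)).2.1 hj)
        (hd3 i j (by omega) (by omega) hij (Ne.symm hj0))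
  have hsub : ∀ i j, i < n → n ≤ j → j < n + k → IsSubperspAxis (a j) (a i) (c i j) :=
    fun i j hi hnj hj => by
      obtain ⟨b, hb, hbq⟩ := (hq j hj).2.2
      by_cases hi0 : i = 0
      · subst hi0
        rw [hc0 j hj]
        exact hbq.isSubperspAxis hb (hd j 0 hj (by omega) (by omega))
      · exact ((hq i (by omega)).2.1 hi).comp hbq hb
          (hd3 i j (by omega) hj (by omega) (by omega))
  have hle : ∀ i, i < n + k → ((Finset.range (n + k)).erase i).sup a ≤ (a i)ᶜ := fun i hi =>
    Finset.sup_le fun j hj => by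
      rw [Finset.mem_erase, Finset.mem_range] at hj
      exact ho j i hj.2 hi hj.1
  refine ⟨c, fun i j => a j ⊓ (perspImage (a i) (a j) (c j i))ᶜ,
    ⟨⟨?_, ?_, ?_, ?_⟩, ?_, hpersp, hsub, ?_, ?_⟩, ?_, fun _ _ _ _ _ => rfl⟩
  · intro t ht i hi hit
    rw [disjoint_iff, inf_comm]
    rw [Finset.mem_range] at hi
    refine inf_eq_bot_of_le_compl (le_trans (Finset.sup_mono ?_) (hle i hi))
    exact fun j hj => Finset.mem_erase.2 ⟨fun h => hit (h ▸ hj), ht hj⟩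
  · exact htop _ fun i hi => Finset.le_sup (Finset.mem_range.2 hi)
  · exact fun i _ hi => hpersp 0 i (by omega) hi
  · exact fun i hi hik => hsub 0 i (by omega) hi hik
  · intro i j hi hj
    rw [hc0 i (by omega), hc0 j hj]
  · exact fun i j _ _ _ => sup_inf_compl inf_le_left
  · exact fun i j _ _ _ => inf_inf_compl _ _
  · refine fun i hi => compl_eq_of_sup_eq_top (hle i hi) (htop _ fun j hj => ?_)
    by_cases hij : j = i
    · exact hij ▸ le_sup_left
    · exact (Finset.le_sup (f := a) (Finset.mem_erase.2 ⟨hij, Finset.mem_range.2 hj⟩)).trans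
        le_sup_right

end ModularOrtholattice

theorem mainTheorem6 {L : Type*} [ModularOrtholattice L]
    (hL : ModularOrtholattice.IsSimple L) (n : ℕ) (hn : 1 ≤ n)
    (hheight : (n : WithBot ℕ∞) ≤ Order.krullDim L) :
    ∃ (k : ℕ) (a : ℕ → L) (c z : ℕ → ℕ → L),
      LatticeFrame.IsStableOrthogonalFrame n k a c z := by
  open ModularOrtholattice in
  obtain ⟨e, he, heo⟩ := exists_orthogonal_ne_bot hheight
  -- The index bound there is inclusive, so `n` elements correspond to `n - 1`.
  obtain ⟨a₀, ha₀e, ha₀, h⟩ := hL.exists_common_persp e (n - 1) fun i hi => he i (by omega)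
  have h' : ∀ i, ∃ f, i < n → (i = 0 → f = a₀) ∧ f ≤ e i ∧
      ∃ c, LatticeFrame.PerspVia c a₀ f := fun i => by
    by_cases hi : i < n
    · by_cases h0 : i = 0
      -- The part of `e 0` is taken to be `a₀` itself, so that the first frame element is the one to
      -- which the others are compared.
      · exact ⟨a₀, fun _ => ⟨fun _ => rfl, h0 ▸ ha₀e, ⊥, .refl _⟩⟩
      · obtain ⟨f, hf, hc⟩ := h i (by omega)
        exact ⟨f, fun _ => ⟨fun h => absurd h h0, hf, hc⟩⟩
    · exact ⟨⊥, fun h => absurd h hi⟩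
  choose f hf using h'
  have hf0 : f 0 = a₀ := (hf 0 hn).1 rfl
  set s := (Finset.range n).sup f
  -- The pieces of `sᶜ` are the last `k` frame elements: orthogonal to every `f i`, and filling up
  -- `⊤` together with `s`.
  obtain ⟨k, b, hbo, hba, hb⟩ := (hL.orthoDecomp ha₀ sᶜ).exists_seq
  have hfs : ∀ i, i < n → f i ≤ s := fun i hi => Finset.le_sup (Finset.mem_range.2 hi)
  have hfb : ∀ i j, i < n → j < k → b j ≤ (f i)ᶜ := fun i j hi hj =>
    ((hb _).1 le_rfl j hj).trans (compl_anti (hfs i hi))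
  refine ⟨k, fun i => if i < n then f i else b (i - n),
    exists_isStableOrthogonalFrame hn _ ?_ ?_ ?_ ?_⟩
  · intro i j hi hj hij
    by_cases h1 : i < n <;> by_cases h2 : j < n <;> simp only [h1, h2, if_true, if_false]
    · exact (hf i h1).2.1.trans ((heo i j h1 h2 hij).trans (compl_anti (hf j h2).2.1))
    · exact le_compl_symm (hfb i _ h1 (by omega))
    · exact hfb j _ h2 (by omega)
    · exact hbo _ _ (by omega) (by omega) (by omega)
  · intro y hy
    rw [← top_le_iff, ← sup_compl_eq_top_mol s]
    refine sup_le (Finset.sup_le fun i hi => ?_) ((hb y).2 fun i hi => ?_)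
    · have hi := Finset.mem_range.1 hi
      simpa [hi] using hy i (by omega)
    · simpa using hy (n + i) (by omega)
  · intro i hi
    simpa [hi, Nat.lt_of_lt_of_le Nat.zero_lt_one hn, hf0] using (hf i hi).2.2
  · intro i hi hik
    simpa [Nat.not_lt.2 hi, Nat.lt_of_lt_of_le Nat.zero_lt_one hn, hf0] using
      hba (i - n) (by omega)
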